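/- Theorem (Benzécri). Let $d \ge 0$, and let $\mathbb{P}^d$ be the real projective space of lines in $\mathbb{R}^{d+1}$. An affine chart of $\mathbb{P}^d$ is the complement of a projective hyperplane, with its natural structure of an affine space. A subset of $\mathbb{P}^d$ is properly convex if it is contained in some affine chart in which it is convex and bounded. Let $$X^{\bullet}=\{(\Omega,x) \mid \Omega \text{ is a properly convex open subset of } \mathbb{P}^d \text{ and } x\in\Omega\},$$ endowed with the Hausdorff topology, i.e. the topology induced by the injection $(\Omega,x)\mapsto(\overline{\Omega},x)$ into the product of the space of nonempty compact subsets of $\mathbb{P}^d$ (with the topology of the Hausdorff distance) and $\mathbb{P}^d$. Then the natural action $g\cdot(\Omega,x)=(g\Omega,gx)$ of $\mathrm{PGL}_{d+1}(\mathbb{R})$ on $X^{\bullet}$ is proper, i.e. the map $\mathrm{PGL}_{d+1}(\mathbb{R})\times X^{\bullet}\to X^{\bullet}\times X^{\bullet}$, $(g,p)\mapsto(g\cdot p,p)$, is proper, and cocompact, i.e. there is a compact set $K\subset X^{\bullet}$ with $\mathrm{PGL}_{d+1}(\mathbb{R})\cdot K=X^{\bullet}$, and the quotient space $\mathrm{PGL}_{d+1}(\mathbb{R})\backslash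 X^{\bullet}$ is compact. -/

import Mathlib

open scoped MatrixGroups Pointwise

noncomputable section

namespace HilbertGeometry

/-- The real projective space `ℙ^d`, the space of lines of `ℝ^(d+1)`. -/
abbrev RealProj (d : ℕ) : Type := Projectivization ℝ (Fin (d + 1) → ℝ)

/-- The map sending a nonzero vector to the line it spans. -/
def proj (d : ℕ) (v : {v : Fin (d + 1) → ℝ // v ≠ 0}) : RealProj d :=
  Projectivization.mk ℝ v.1 v.2

/-- `ℙ^d` carries the quotient topology from `ℝ^(d+1) ∖ {0}`. -/
instance instTopologicalSpaceRealProj (d : ℕ) : TopologicalSpace (RealProj d) :=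
  TopologicalSpace.coinduced (proj d) inferInstance

/-- `PGL` carries the quotient topology from `GL`. -/
instance instTopologicalSpacePGL (d : ℕ) : TopologicalSpace PGL(Fin (d + 1), ℝ) :=
  TopologicalSpace.coinduced
    (Matrix.ProjGenLinGroup.mk : GL (Fin (d + 1)) ℝ → PGL(Fin (d + 1), ℝ)) inferInstance

/-- The affine chart of `ℙ^d` that is the complement of the projective hyperplane `{f = 0}`. -/
def affineChart {d : ℕ} (f : Module.Dual ℝ (Fin (d + 1) → ℝ)) : Set (RealProj d) :=
  {p | f p.rep ≠ 0}

/-- The part of `C` in the chart `affineChart f`, read in the affine space `{v | f v = 1}` with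
which that chart is identified (each line outside `{f = 0}` meets it in exactly one vector). -/
def inChart {d : ℕ} (f : Module.Dual ℝ (Fin (d + 1) → ℝ)) (C : Set (RealProj d)) :
    Set (Fin (d + 1) → ℝ) :=
  {v | f v = 1 ∧ ∃ hv : v ≠ 0, Projectivization.mk ℝ v hv ∈ C}

/-- `C` is properly convex: it is contained in some affine chart, in which it is convex and
bounded. -/
def IsProperlyConvex {d : ℕ} (C : Set (RealProj d)) : Prop :=
  ∃ f : Module.Dual ℝ (Fin (d + 1) → ℝ), f ≠ 0 ∧ C ⊆ affineChart f ∧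
    Convex ℝ (inChart f C) ∧ Bornology.IsBounded (inChart f C)

/-- The space `X•` of pairs `(Ω, x)` with `Ω` a properly convex open subset of `ℙ^d`
and `x ∈ Ω`. -/
@[ext]
structure PointedDomain (d : ℕ) where
  carrier : Set (RealProj d)
  point : RealProj d
  isOpen_carrier : IsOpen carrier
  isProperlyConvex : IsProperlyConvex carrier
  point_mem : point ∈ carrier

theorem continuous_proj (d : ℕ) : Continuous (proj d) := continuous_coinduced_rng

theorem proj_surjective (d : ℕ) : Function.Surjective (proj d) := by
  intro p
  exact ⟨⟨p.rep, p.rep_nonzero⟩, p.mk_rep⟩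

theorem mk_mem_affineChart {d : ℕ} (f : Module.Dual ℝ (Fin (d + 1) → ℝ))
    (v : Fin (d + 1) → ℝ) (hv : v ≠ 0) :
    Projectivization.mk ℝ v hv ∈ affineChart f ↔ f v ≠ 0 := by
  obtain ⟨a, ha⟩ := Projectivization.exists_smul_eq_mk_rep ℝ v hv
  change f (Projectivization.mk ℝ v hv).rep ≠ 0 ↔ _
  rw [← ha, Units.smul_def, map_smul, smul_eq_mul]
  simp

instance instCompactSpaceRealProj (d : ℕ) : CompactSpace (RealProj d) := by
  have hK : IsCompact {v : {v : Fin (d + 1) → ℝ // v ≠ 0} | ‖v.1‖ = 1} := by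
    rw [Subtype.isCompact_iff]
    have hS : (Subtype.val '' {v : {v : Fin (d + 1) → ℝ // v ≠ 0} | ‖v.1‖ = 1}) =
        Metric.sphere (0 : Fin (d + 1) → ℝ) 1 := by
      ext v
      constructor
      · rintro ⟨w, hw, rfl⟩
        simpa using hw
      · intro hv
        have h1 : ‖v‖ = 1 := by simpa using hv
        refine ⟨⟨v, ?_⟩, h1, rfl⟩
        rintro rfl
        simp at h1
    rw [hS]
    exact isCompact_sphere _ _
  refine ⟨?_⟩
  convert hK.image (continuous_proj d)
  symm
  rw [Set.eq_univ_iff_forall]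
  intro p
  obtain ⟨⟨v, hv⟩, rfl⟩ := proj_surjective d p
  have hn : ‖v‖ ≠ 0 := norm_ne_zero_iff.2 hv
  refine ⟨⟨‖v‖⁻¹ • v, smul_ne_zero (inv_ne_zero hn) hv⟩, ?_, ?_⟩
  · simp [norm_smul, hn]
  · exact (Projectivization.mk_eq_mk_iff' ℝ _ _ _ _).2 ⟨‖v‖⁻¹, rfl⟩

/-- The closure of `Ω`, a nonempty compact subset of `ℙ^d`. -/
def PointedDomain.closure {d : ℕ} (p : PointedDomain d) :
    TopologicalSpace.NonemptyCompacts (RealProj d) where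
  carrier := _root_.closure p.carrier
  isCompact' := isClosed_closure.isCompact
  nonempty' := ⟨p.point, subset_closure p.point_mem⟩

/-- The Hausdorff topology on `X•`: a pair `(Ω, x)` is close to `(Ω', x')` when the compact sets
`closure Ω` and `closure Ω'` are close for the Hausdorff distance, and `x` is close to `x'`.
The topology on `NonemptyCompacts` is the one of the Hausdorff distance of any metric that induces
the topology of `ℙ^d` (it does not depend on the metric). -/
instance instTopologicalSpacePointedDomain (d : ℕ) : TopologicalSpace (PointedDomain d) :=
  TopologicalSpace.induced
    (fun p : PointedDomain d ↦ (p.closure, p.point)) inferInstance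

/-- Each element of `PGL` acts on `ℙ^d` by a continuous map. -/
instance instContinuousConstSMulRealProj (d : ℕ) : ContinuousConstSMul PGL(Fin (d + 1), ℝ) (RealProj d) where
  continuous_const_smul g := by
    induction g using Matrix.ProjGenLinGroup.induction_on with
    | mk g =>
      refine continuous_coinduced_dom.2 ?_
      have h : Continuous fun v : {v : Fin (d + 1) → ℝ // v ≠ 0} ↦
          (⟨g • v.1, (smul_ne_zero_iff_ne g).2 v.2⟩ : {v : Fin (d + 1) → ℝ // v ≠ 0}) := by
        refine Continuous.subtype_mk ?_ _
        exact (Continuous.matrix_mulVec continuous_const continuous_subtype_val)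
      exact (continuous_proj d).comp h

theorem IsProperlyConvex.smul {d : ℕ} {C : Set (RealProj d)} (hC : IsProperlyConvex C)
    (g : PGL(Fin (d + 1), ℝ)) : IsProperlyConvex (g • C) := by
  induction g using Matrix.ProjGenLinGroup.induction_on with
  | mk g =>
    obtain ⟨f, hf, hsub, hconv, hbdd⟩ := hC
    have key : inChart (f ∘ₗ Matrix.mulVecLin (g⁻¹ : GL (Fin (d + 1)) ℝ).1)
        (Matrix.ProjGenLinGroup.mk g • C) = Matrix.mulVecLin g.1 '' inChart f C := by
      ext w
      constructor
      · rintro ⟨h1, hw, h2⟩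
        refine ⟨g⁻¹ • w, ⟨h1, (smul_ne_zero_iff_ne _).2 hw, ?_⟩, ?_⟩
        · rw [Set.mem_smul_set_iff_inv_smul_mem, ← map_inv] at h2
          exact h2
        · exact smul_inv_smul g w
      · rintro ⟨v, ⟨h1, hv, h2⟩, rfl⟩
        refine ⟨?_, (smul_ne_zero_iff_ne g).2 hv, ?_⟩
        · change f (g⁻¹ • g • v) = 1
          rwa [inv_smul_smul]
        · exact Set.smul_mem_smul_set h2
    refine ⟨f ∘ₗ Matrix.mulVecLin (g⁻¹ : GL (Fin (d + 1)) ℝ).1, ?_, ?_, ?_, ?_⟩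
    · intro h
      apply hf
      refine LinearMap.ext fun v ↦ ?_
      have := LinearMap.congr_fun h (g • v)
      change f (g⁻¹ • g • v) = 0 at this
      rwa [inv_smul_smul] at this
    · rintro _ ⟨p, hp, rfl⟩
      obtain ⟨⟨v, hv⟩, rfl⟩ := proj_surjective d p
      have := (mk_mem_affineChart f v hv).1 (hsub hp)
      refine (mk_mem_affineChart _ (g • v) ((smul_ne_zero_iff_ne g).2 hv)).2 ?_
      change f (g⁻¹ • g • v) ≠ 0
      rwa [inv_smul_smul]
    · rw [key]
      exact hconv.linear_image _
    · rw [key]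
      exact ((LinearMap.toContinuousLinearMap (Matrix.mulVecLin g.1)).lipschitz).isBounded_image
        hbdd

/-- The action of `PGL` on `X•`: `g • (Ω, x) = (g Ω, g x)`. -/
instance instMulActionPointedDomain (d : ℕ) : MulAction PGL(Fin (d + 1), ℝ) (PointedDomain d) where
  smul g p :=
    { carrier := g • p.carrier
      point := g • p.point
      isOpen_carrier := p.isOpen_carrier.smul g
      isProperlyConvex := p.isProperlyConvex.smul g
      point_mem := Set.smul_mem_smul_set p.point_mem }
  one_smul p := PointedDomain.ext (one_smul _ p.carrier) (one_smul _ p.point)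
  mul_smul g h p := PointedDomain.ext (mul_smul g h p.carrier) (mul_smul g h p.point)

/-- The action of a group on a topological space is cocompact: the translates of some compact
subset cover the space, and the quotient space is compact. -/
def IsCocompactAction (G X : Type*) [Group G] [TopologicalSpace X] [MulAction G X] : Prop :=
  (∃ K : Set X, IsCompact K ∧ ⋃ g : G, g • K = Set.univ) ∧
    CompactSpace (MulAction.orbitRel.Quotient G X)

end HilbertGeometry

end

/-! A properly convex open set is the interior of its closure, so `X•` embeds in the product of the
hyperspace of `ℙ^d` and `ℙ^d`. Convexity is handled on cones: over a set contained in two charts,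
the two cones agree up to sign.

Properness. Let `p → p₀` and `g • p → q₀` along an ultrafilter. Matrices of `g` and `g⁻¹` of norm
one converge to nonzero `A` and `B`. The crux is that `A` does not kill the point of `p₀`
(`mulVec_ne_zero_of_tendsto`). If `f` does not vanish on the closure of `q₀`, then `f ∘ g`
eventually has constant sign on the cone over `p`, so `f ∘ A` has constant weak sign on the open
cone over `p₀`. If `A` killed a vector of that cone, `f ∘ A` would have an extremum at an interior
point, hence be zero. Boundedness leaves room to perturb `f` in every coordinate direction, which
forces `A = 0`. The same holds for `B`. Finally `A * B` is scalar and does not kill the point of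
`q₀`, so `A` is invertible and its class is the limit of `g`.

Cocompactness. For a cone `C` and `x ∈ C`, the slice `{u | u ⬝ x = 1}` of the dual cone is compact.
Let the rows of `A` be `d + 1` of its points with maximal `|det|` (`exists_normalizing_matrix`).
Then `A` sends `x` to `(1, …, 1)` and `C` into the nonnegative orthant. By Cramer's rule and
maximality, each point of the slice is a combination of the rows with coefficients in `[-1, 1]` of
sum `1`, hence is positive on the preimage of a fixed box; so `A C` contains this box. The convex
compact sets between the box and the simplex form a compact family. -/

namespace HilbertGeometry

open Set Filter Topology TopologicalSpace

variable {d : ℕ}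

/-! ### Topology of `ℙ^d` -/

theorem isOpenQuotientMap_proj (d : ℕ) : IsOpenQuotientMap (proj d) := by
  refine ⟨proj_surjective d, continuous_proj d, fun U hU ↦ isOpen_coinduced.2 ?_⟩
  have h : proj d ⁻¹' (proj d '' U) = ⋃ a : ℝˣ,
      (fun v : {v : Fin (d + 1) → ℝ // v ≠ 0} ↦
        (⟨(a : ℝ) • v.1, smul_ne_zero a.ne_zero v.2⟩ : {v : Fin (d + 1) → ℝ // v ≠ 0})) ⁻¹' U := by
    ext v
    simp only [mem_preimage, mem_image, mem_iUnion]
    constructor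
    · rintro ⟨w, hw, h⟩
      obtain ⟨a, ha⟩ := (Projectivization.mk_eq_mk_iff ℝ _ _ w.2 v.2).1 h
      refine ⟨a, ?_⟩
      convert hw
      exact ha
    · rintro ⟨a, ha⟩
      exact ⟨_, ha, (Projectivization.mk_eq_mk_iff ℝ _ _ _ v.2).2 ⟨a, rfl⟩⟩
  rw [h]
  refine isOpen_iUnion fun a ↦ hU.preimage ?_
  exact Continuous.subtype_mk (continuous_subtype_val.const_smul (a : ℝ)) _

/-- The vanishing of all `2 × 2` minors is a closed condition, which makes the quotient Hausdorff.
-/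
theorem mk_eq_mk_iff_cross (v w : Fin (d + 1) → ℝ) (hv : v ≠ 0) (hw : w ≠ 0) :
    Projectivization.mk ℝ v hv = Projectivization.mk ℝ w hw ↔
      ∀ i j, v i * w j = v j * w i := by
  rw [Projectivization.mk_eq_mk_iff']
  constructor
  · rintro ⟨a, rfl⟩ i j
    simp only [Pi.smul_apply, smul_eq_mul]
    ring
  · intro h
    obtain ⟨j, hj⟩ := Function.ne_iff.1 hw
    simp only [Pi.zero_apply] at hj
    refine ⟨v j / w j, funext fun i ↦ ?_⟩
    simp only [Pi.smul_apply, smul_eq_mul]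
    field_simp
    linarith [h i j]

instance instT2SpaceRealProj (d : ℕ) : T2Space (RealProj d) := by
  rw [t2Space_iff_of_isOpenQuotientMap (isOpenQuotientMap_proj d)]
  simp only [proj, mk_eq_mk_iff_cross, ofPred_forall]
  have hc : ∀ k, Continuous fun v : {v : Fin (d + 1) → ℝ // v ≠ 0} ↦ v.1 k := fun k ↦
    (continuous_apply k).comp continuous_subtype_val
  exact isClosed_iInter fun i ↦ isClosed_iInter fun j ↦ isClosed_eq
    (((hc i).comp continuous_fst).mul ((hc j).comp continuous_snd))
    (((hc j).comp continuous_fst).mul ((hc i).comp continuous_snd))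

/-! ### Cones over subsets of a chart -/

/-- The vectors on the positive side of `f` that span a line of `S`. -/
def coneOver (f : Module.Dual ℝ (Fin (d + 1) → ℝ)) (S : Set (RealProj d)) :
    Set (Fin (d + 1) → ℝ) :=
  {v | 0 < f v ∧ ∃ hv : v ≠ 0, Projectivization.mk ℝ v hv ∈ S}

section coneOver

variable {f : Module.Dual ℝ (Fin (d + 1) → ℝ)} {S T : Set (RealProj d)}
  {v w : Fin (d + 1) → ℝ}

theorem continuous_dual (f : Module.Dual ℝ (Fin (d + 1) → ℝ)) : Continuous f :=
  f.continuous_of_finiteDimensional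

theorem mk_smul_eq {a : ℝ} (ha : a ≠ 0) (hv : v ≠ 0) :
    Projectivization.mk ℝ (a • v) (smul_ne_zero ha hv) = Projectivization.mk ℝ v hv :=
  (Projectivization.mk_eq_mk_iff' ℝ _ _ _ _).2 ⟨a, rfl⟩

theorem coneOver_mono (h : S ⊆ T) : coneOver f S ⊆ coneOver f T :=
  fun _ hv ↦ ⟨hv.1, hv.2.imp fun _ h' ↦ h h'⟩

theorem smul_mem_coneOver {a : ℝ} (ha : 0 < a) (hv : v ∈ coneOver f S) :
    a • v ∈ coneOver f S := by
  obtain ⟨h, hv0, hS⟩ := hv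
  refine ⟨by simpa using mul_pos ha h, smul_ne_zero ha.ne' hv0, ?_⟩
  rwa [mk_smul_eq ha.ne' hv0]

theorem exists_mem_coneOver (hS : S ⊆ affineChart f) {p : RealProj d} (hp : p ∈ S) :
    ∃ v ∈ coneOver f S, ∃ hv : v ≠ 0, Projectivization.mk ℝ v hv = p := by
  rcases lt_or_gt_of_ne (hS hp) with h | h
  · have hn : Projectivization.mk ℝ (-p.rep) (neg_ne_zero.2 p.rep_nonzero) = p := by
      conv_rhs => rw [← p.mk_rep]
      exact (Projectivization.mk_eq_mk_iff' ℝ _ _ _ _).2 ⟨-1, by simp⟩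
    exact ⟨-p.rep, ⟨by simpa using h, neg_ne_zero.2 p.rep_nonzero, by rwa [hn]⟩, _, hn⟩
  · exact ⟨p.rep, ⟨h, p.rep_nonzero, by rwa [p.mk_rep]⟩, p.rep_nonzero, p.mk_rep⟩

theorem subset_of_coneOver_subset (hS : S ⊆ affineChart f) (h : coneOver f S ⊆ coneOver f T) :
    S ⊆ T := by
  intro p hp
  obtain ⟨v, hv, hv0, rfl⟩ := exists_mem_coneOver hS hp
  exact (h hv).2.2

theorem isOpen_exists_mk_mem (hS : IsOpen S) :
    IsOpen {v : Fin (d + 1) → ℝ | ∃ hv : v ≠ 0, Projectivization.mk ℝ v hv ∈ S} := by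
  have h0 : IsOpen {v : Fin (d + 1) → ℝ | v ≠ 0} := isOpen_ne
  convert h0.isOpenMap_subtype_val _ (hS.preimage (continuous_proj d)) using 1
  ext v
  constructor
  · rintro ⟨hv, hS⟩
    exact ⟨⟨v, hv⟩, hS, rfl⟩
  · rintro ⟨⟨v, hv⟩, hS, rfl⟩
    exact ⟨hv, hS⟩

theorem isOpen_coneOver (hS : IsOpen S) : IsOpen (coneOver f S) :=
  (isOpen_lt continuous_const (continuous_dual f)).inter (isOpen_exists_mk_mem hS)

theorem isOpen_image_mk {A : Set (Fin (d + 1) → ℝ)} (hA : IsOpen A) :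
    IsOpen {p : RealProj d | ∃ v ∈ A, ∃ hv : v ≠ 0, Projectivization.mk ℝ v hv = p} := by
  convert (isOpenQuotientMap_proj d).isOpenMap _ (hA.preimage continuous_subtype_val) using 1
  ext p
  constructor
  · rintro ⟨v, hA, hv, rfl⟩
    exact ⟨⟨v, hv⟩, hA, rfl⟩
  · rintro ⟨⟨v, hv⟩, hA, rfl⟩
    exact ⟨v, hA, hv, rfl⟩

theorem isOpen_affineChart (f : Module.Dual ℝ (Fin (d + 1) → ℝ)) : IsOpen (affineChart f) := by
  convert isOpen_image_mk (isOpen_ne_fun (continuous_dual f) (continuous_const (y := (0 : ℝ))))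
    using 1
  ext p
  constructor
  · intro h
    exact ⟨p.rep, h, p.rep_nonzero, p.mk_rep⟩
  · rintro ⟨v, hA, hv, rfl⟩
    exact (mk_mem_affineChart f v hv).2 hA

theorem ne_zero_of_dual_pos (h : 0 < f v) : v ≠ 0 := by
  rintro rfl
  simp at h

theorem coneOver_closure :
    coneOver f (closure S) = closure (coneOver f S) ∩ {v | 0 < f v} := by
  have hf := isOpen_lt (continuous_const (y := (0 : ℝ))) (continuous_dual f)
  ext v
  constructor
  · rintro ⟨h, hv, hS⟩
    refine ⟨mem_closure_iff.2 fun N hN hvN ↦ ?_, h⟩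
    obtain ⟨_, ⟨w, hw, hw0, rfl⟩, hwS⟩ := mem_closure_iff.1 hS _ (isOpen_image_mk (hN.inter hf))
      ⟨v, ⟨hvN, h⟩, hv, rfl⟩
    exact ⟨w, hw.1, hw.2, hw0, hwS⟩
  · rintro ⟨hcl, h⟩
    refine ⟨h, ne_zero_of_dual_pos h, mem_closure_iff.2 fun O hO hvO ↦ ?_⟩
    obtain ⟨w, ⟨_, hw0, hwO⟩, ⟨_, _, hwS⟩⟩ := mem_closure_iff.1 hcl _
      (isOpen_coneOver (f := f) hO) ⟨h, _, hvO⟩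
    exact ⟨_, hwO, hwS⟩

theorem coneOver_interior : coneOver f (interior S) = interior (coneOver f S) := by
  apply Subset.antisymm
  · exact interior_maximal (coneOver_mono interior_subset) (isOpen_coneOver isOpen_interior)
  · intro v hv
    have h := interior_subset hv
    refine ⟨h.1, h.2.1, mem_interior.2 ⟨_, ?_, isOpen_image_mk isOpen_interior,
      ⟨v, hv, h.2.1, rfl⟩⟩⟩
    rintro _ ⟨w, hw, hw0, rfl⟩
    exact (interior_subset hw).2.2

theorem inv_smul_mem_inChart (hv : v ∈ coneOver f S) : (f v)⁻¹ • v ∈ inChart f S := by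
  have h := smul_mem_coneOver (inv_pos.2 hv.1) hv
  exact ⟨by simp [hv.1.ne'], h.2⟩

theorem inChart_eq : inChart f S = coneOver f S ∩ {v | f v = 1} := by
  ext v
  constructor
  · rintro ⟨h, h'⟩
    exact ⟨⟨by simp [h], h'⟩, h⟩
  · rintro ⟨h, h'⟩
    exact ⟨h', h.2⟩

/-- A convex combination of `v` and `w` is a positive multiple of a convex combination of their
rescalings to `f = 1`. -/
theorem convex_inChart_iff : Convex ℝ (inChart f S) ↔ Convex ℝ (coneOver f S) := by
  constructor
  · intro h v hv w hw a b ha hb hab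
    have hv' := inv_smul_mem_inChart hv
    have hw' := inv_smul_mem_inChart hw
    have hs : 0 < a * f v + b * f w := by
      have h1 := hv.1
      have h2 := hw.1
      rcases ha.eq_or_lt with rfl | ha
      · have : b = 1 := by linarith
        simp [this, h2]
      · have := mul_nonneg hb h2.le
        have := mul_pos ha h1
        linarith
    have := h hv' hw' (a := a * f v / (a * f v + b * f w)) (b := b * f w / (a * f v + b * f w))
      (div_nonneg (mul_nonneg ha hv.1.le) hs.le) (div_nonneg (mul_nonneg hb hw.1.le) hs.le)
      (by field_simp)
    rw [inChart_eq] at this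
    have h3 := smul_mem_coneOver hs this.1
    convert h3 using 1
    have h1 := hv.1.ne'
    have h2 := hw.1.ne'
    rw [smul_add, smul_smul, smul_smul, smul_smul, smul_smul]
    congr 2 <;> field_simp
  · intro h
    rw [inChart_eq]
    exact h.inter (convex_hyperplane f.isLinear 1)

end coneOver

/-! ### Signs of functionals and change of chart -/

theorem dual_pos_or_neg_of_convex {f : Module.Dual ℝ (Fin (d + 1) → ℝ)}
    {C : Set (Fin (d + 1) → ℝ)} (hC : Convex ℝ C) (h : ∀ v ∈ C, f v ≠ 0) :
    (∀ v ∈ C, 0 < f v) ∨ ∀ v ∈ C, f v < 0 := by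
  by_contra! hcon
  obtain ⟨⟨v, hv, hfv⟩, w, hw, hfw⟩ := hcon
  have hfv := hfv.lt_of_ne (h v hv)
  have hfw := hfw.lt_of_ne (h w hw).symm
  have hs : 0 < f w - f v := by linarith
  -- The zero of `f` on the segment from `v` to `w`.
  refine h _ (hC hv hw (a := f w / (f w - f v)) (b := -f v / (f w - f v))
    (div_nonneg hfw.le hs.le) (div_nonneg (by linarith) hs.le) ?_) ?_
  · field_simp
    ring
  · simp only [map_add, map_smul, smul_eq_mul]
    field_simp
    ring

/-- A linear functional with a local minimum has zero derivative in every direction. -/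
theorem eq_zero_of_nonneg_on_open {f : Module.Dual ℝ (Fin (d + 1) → ℝ)}
    {C : Set (Fin (d + 1) → ℝ)} (hC : IsOpen C) (h : ∀ v ∈ C, 0 ≤ f v)
    {x : Fin (d + 1) → ℝ} (hx : x ∈ C) (hfx : f x = 0) : f = 0 := by
  refine LinearMap.ext fun u ↦ ?_
  have hmin : IsLocalMin (fun t : ℝ ↦ f (x + t • u)) 0 := by
    have hc : Continuous fun t : ℝ ↦ x + t • u := by fun_prop
    have h0 : ∀ᶠ t in 𝓝 (0 : ℝ), x + t • u ∈ C :=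
      hc.continuousAt.eventually_mem (hC.mem_nhds (by simpa using hx))
    filter_upwards [h0] with t ht
    simpa [hfx] using h _ ht
  have hd : HasDerivAt (fun t : ℝ ↦ f (x + t • u)) (f u) 0 := by
    simpa [hfx] using (hasDerivAt_id (0 : ℝ)).mul_const (f u)
  exact hmin.hasDerivAt_eq_zero hd

/-- The coordinate functionals of `ℝ^(d+1)`. -/
abbrev coordDual (i : Fin (d + 1)) : Module.Dual ℝ (Fin (d + 1) → ℝ) := LinearMap.proj i

/-- `f'` has constant sign on the convex cone, so the two cones are equal or opposite. This lets one
chart around a limit domain serve all nearby domains. -/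
theorem convex_coneOver_of_subset_affineChart {f f' : Module.Dual ℝ (Fin (d + 1) → ℝ)}
    {S : Set (RealProj d)} (hS : S ⊆ affineChart f) (hS' : S ⊆ affineChart f')
    (h : Convex ℝ (coneOver f S)) : Convex ℝ (coneOver f' S) := by
  have hne : ∀ v ∈ coneOver f S, f' v ≠ 0 := fun v hv ↦
    (mk_mem_affineChart f' v hv.2.1).1 (hS' hv.2.2)
  have hneg : ∀ (v : Fin (d + 1) → ℝ) (hv : v ≠ 0), Projectivization.mk ℝ v hv ∈ S →
      v ∈ coneOver f S ∨ -v ∈ coneOver f S := by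
    intro v hv hvS
    have hn : Projectivization.mk ℝ (-v) (neg_ne_zero.2 hv) = Projectivization.mk ℝ v hv :=
      (Projectivization.mk_eq_mk_iff' ℝ _ _ _ _).2 ⟨-1, by simp⟩
    rcases lt_or_gt_of_ne ((mk_mem_affineChart f v hv).1 (hS hvS)) with h0 | h0
    · exact Or.inr ⟨by simpa using h0, neg_ne_zero.2 hv, by rwa [hn]⟩
    · exact Or.inl ⟨h0, hv, hvS⟩
  rcases dual_pos_or_neg_of_convex h hne with hpos | hneg'
  · convert h using 1
    ext v
    refine ⟨fun ⟨hv, hv0, hvS⟩ ↦ ?_, fun hv ↦ ⟨hpos v hv, hv.2⟩⟩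
    refine (hneg v hv0 hvS).resolve_right fun h' ↦ ?_
    have := hpos _ h'
    simp only [map_neg] at this
    linarith
  · suffices hs : coneOver f' S = -coneOver f S from hs ▸ h.neg
    ext v
    rw [Set.mem_neg]
    refine ⟨fun ⟨hv, hv0, hvS⟩ ↦ ?_, fun hv ↦ ⟨?_, neg_ne_zero.1 hv.2.1, ?_⟩⟩
    · refine (hneg v hv0 hvS).resolve_left fun h' ↦ ?_
      have := hneg' _ h'
      linarith
    · simpa using hneg' _ hv
    · have hn : Projectivization.mk ℝ (-v) hv.2.1 =
          Projectivization.mk ℝ v (neg_ne_zero.1 hv.2.1) :=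
        (Projectivization.mk_eq_mk_iff' ℝ _ _ _ _).2 ⟨-1, by simp⟩
      rw [← hn]
      exact hv.2.2

/-- The inequality is homogeneous and closed, so it passes from the slice `f = 1` to all
representatives and then to the closure. -/
theorem exists_norm_le_of_isBounded {f : Module.Dual ℝ (Fin (d + 1) → ℝ)}
    {S : Set (RealProj d)} (hS : S ⊆ affineChart f) (hb : Bornology.IsBounded (inChart f S)) :
    ∃ M : ℝ, 0 < M ∧ ∀ (v : Fin (d + 1) → ℝ) (hv : v ≠ 0),
      Projectivization.mk ℝ v hv ∈ closure S → ‖v‖ ≤ M * |f v| := by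
  obtain ⟨M, hM, hbM⟩ := hb.exists_pos_norm_le
  refine ⟨M, hM, fun v hv hvS ↦ ?_⟩
  have hcl : IsClosed {v : {v : Fin (d + 1) → ℝ // v ≠ 0} | ‖v.1‖ ≤ M * |f v.1|} :=
    isClosed_le continuous_subtype_val.norm
      (((continuous_dual f).comp continuous_subtype_val).abs.const_mul M)
  have hpre : proj d ⁻¹' closure S ⊆ {v | ‖v.1‖ ≤ M * |f v.1|} := by
    rw [(isOpenQuotientMap_proj d).isOpenMap.preimage_closure_eq_closure_preimage
      (continuous_proj d)]
    refine closure_minimal ?_ hcl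
    rintro ⟨w, hw⟩ hwS
    have hfw : f w ≠ 0 := (mk_mem_affineChart f w hw).1 (hS hwS)
    have h1 : (f w)⁻¹ • w ∈ inChart f S := by
      refine ⟨by simp [hfw], smul_ne_zero (inv_ne_zero hfw) hw, ?_⟩
      rw [mk_smul_eq (inv_ne_zero hfw) hw]
      exact hwS
    have h2 := hbM _ h1
    rw [norm_smul, norm_inv, Real.norm_eq_abs, inv_mul_le_iff₀ (abs_pos.2 hfw)] at h2
    simpa [mul_comm] using h2
  exact hpre (show (⟨v, hv⟩ : {v : Fin (d + 1) → ℝ // v ≠ 0}) ∈ proj d ⁻¹' closure S from hvS)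

/-- If a set is bounded in a chart, then its closure lies in the charts of all functionals that
are small perturbations of the given one along a coordinate functional. -/
theorem exists_perturbation {f : Module.Dual ℝ (Fin (d + 1) → ℝ)}
    {S : Set (RealProj d)} (hS : S ⊆ affineChart f) (hb : Bornology.IsBounded (inChart f S)) :
    ∃ ε : ℝ, 0 < ε ∧ ∀ (t : ℝ), |t| ≤ ε → ∀ i,
      closure S ⊆ affineChart (f + t • coordDual i) ∧
      ∀ v ∈ coneOver f (closure S), 0 < (f + t • coordDual i) v := by
  obtain ⟨M, hM, h⟩ := exists_norm_le_of_isBounded hS hb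
  have key : ∀ (t : ℝ), |t| ≤ (2 * M)⁻¹ → ∀ i (v : Fin (d + 1) → ℝ) (hv : v ≠ 0),
      Projectivization.mk ℝ v hv ∈ closure S → |t * v i| < |f v| := by
    intro t ht i v hv hvS
    have h1 := h v hv hvS
    have h2 : 0 < ‖v‖ := norm_pos_iff.2 hv
    have h3 : |v i| ≤ ‖v‖ := norm_le_pi_norm v i
    have h4 : 0 < |f v| := by
      by_contra! h5
      nlinarith
    rw [abs_mul]
    calc |t| * |v i| ≤ (2 * M)⁻¹ * (M * |f v|) := by gcongr; linarith
      _ = |f v| / 2 := by field_simp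
      _ < |f v| := by linarith
  -- For such `t` the perturbation is at most half of `|f v|`, and `f v ≠ 0`.
  refine ⟨(2 * M)⁻¹, by positivity, fun t ht i ↦ ⟨fun p hp ↦ ?_, fun v hv ↦ ?_⟩⟩
  · rw [← p.mk_rep] at hp ⊢
    rw [mk_mem_affineChart]
    have := key t ht i _ p.rep_nonzero hp
    intro h0
    simp only [LinearMap.add_apply, LinearMap.smul_apply, LinearMap.proj_apply,
      smul_eq_mul] at h0
    rw [eq_neg_of_add_eq_zero_left h0, abs_neg] at this
    exact this.false
  · have := key t ht i v hv.2.1 hv.2.2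
    rw [abs_of_pos hv.1] at this
    simp only [LinearMap.add_apply, LinearMap.smul_apply, LinearMap.proj_apply,
      smul_eq_mul]
    linarith [neg_abs_le (t * v i)]

/-! ### Domains are determined by their closures -/

namespace PointedDomain

/-- A domain is convex in some chart such that its closure lies in this chart and in the charts of
all small perturbations of the defining functional. -/
theorem exists_chart (p : PointedDomain d) :
    ∃ f : Module.Dual ℝ (Fin (d + 1) → ℝ), _root_.closure p.carrier ⊆ affineChart f ∧
      Convex ℝ (coneOver f p.carrier) ∧ ∃ ε : ℝ, 0 < ε ∧ ∀ (t : ℝ), |t| ≤ ε → ∀ i,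
      _root_.closure p.carrier ⊆ affineChart (f + t • coordDual i) ∧
      ∀ v ∈ coneOver f (_root_.closure p.carrier), 0 < (f + t • coordDual i) v := by
  obtain ⟨f, -, hS, hc, hb⟩ := p.isProperlyConvex
  obtain ⟨ε, hε, h⟩ := exists_perturbation hS hb
  refine ⟨f, ?_, convex_inChart_iff.1 hc, ε, hε, h⟩
  simpa using (h 0 (by simpa using hε.le) 0).1

theorem interior_closure_carrier (p : PointedDomain d) :
    interior (_root_.closure p.carrier) = p.carrier := by
  obtain ⟨f, hS, hc, -⟩ := p.exists_chart
  refine Subset.antisymm ?_ (interior_maximal subset_closure p.isOpen_carrier)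
  refine subset_of_coneOver_subset (interior_subset.trans hS) ?_
  have ho := isOpen_coneOver (f := f) p.isOpen_carrier
  obtain ⟨v, hv, -⟩ := exists_mem_coneOver (subset_closure.trans hS) p.point_mem
  rw [coneOver_interior, coneOver_closure, interior_inter,
    hc.interior_closure_eq_interior_of_nonempty_interior (by rw [ho.interior_eq]; exact ⟨v, hv⟩),
    ho.interior_eq]
  exact inter_subset_left

theorem coe_closure (p : PointedDomain d) :
    (p.closure : Set (RealProj d)) = _root_.closure p.carrier := rfl

theorem closure_point_injective :
    Function.Injective fun p : PointedDomain d ↦ (p.closure, p.point) := by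
  intro p q h
  obtain ⟨h1, h2⟩ := Prod.ext_iff.1 h
  refine PointedDomain.ext ?_ h2
  rw [← p.interior_closure_carrier, ← q.interior_closure_carrier, ← coe_closure, ← coe_closure]
  exact congrArg (fun K : NonemptyCompacts (RealProj d) ↦ interior (K : Set (RealProj d))) h1

theorem isEmbedding_closure_point :
    IsEmbedding fun p : PointedDomain d ↦ (p.closure, p.point) :=
  ⟨⟨rfl⟩, closure_point_injective⟩

instance instT2Space (d : ℕ) : T2Space (PointedDomain d) :=
  isEmbedding_closure_point.t2Space

theorem continuous_closure : Continuous (PointedDomain.closure : PointedDomain d → _) :=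
  continuous_fst.comp isEmbedding_closure_point.continuous

theorem continuous_point : Continuous (PointedDomain.point : PointedDomain d → _) :=
  continuous_snd.comp isEmbedding_closure_point.continuous

end PointedDomain

/-! ### Continuity of the action -/

theorem isOpenQuotientMap_projGenLinGroup_mk (d : ℕ) :
    IsOpenQuotientMap (Matrix.ProjGenLinGroup.mk : GL (Fin (d + 1)) ℝ → PGL(Fin (d + 1), ℝ)) :=
  QuotientGroup.isOpenQuotientMap_mk (N := Subgroup.center (GL (Fin (d + 1)) ℝ))

/-- A product of open quotient maps is a quotient map, so continuity may be tested on matrices and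
vectors. -/
instance instContinuousSMulRealProj (d : ℕ) :
    ContinuousSMul PGL(Fin (d + 1), ℝ) (RealProj d) where
  continuous_smul := by
    have hq := (isOpenQuotientMap_projGenLinGroup_mk d).prodMap (isOpenQuotientMap_proj d)
    refine hq.isQuotientMap.continuous_iff.2 ?_
    have h : Continuous fun x : GL (Fin (d + 1)) ℝ × {v : Fin (d + 1) → ℝ // v ≠ 0} ↦
        (⟨x.1 • x.2.1, (smul_ne_zero_iff_ne x.1).2 x.2.2⟩ : {v : Fin (d + 1) → ℝ // v ≠ 0}) := by
      refine Continuous.subtype_mk ?_ _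
      exact Continuous.matrix_mulVec (Units.continuous_val.comp continuous_fst)
        (continuous_subtype_val.comp continuous_snd)
    exact (continuous_proj d).comp h

theorem PointedDomain.closure_smul (g : PGL(Fin (d + 1), ℝ)) (p : PointedDomain d) :
    (g • p).closure = p.closure.map (g • ·) (continuous_const_smul g) := by
  refine NonemptyCompacts.ext ?_
  exact _root_.closure_smul g p.carrier

instance instContinuousSMulPointedDomain (d : ℕ) :
    ContinuousSMul PGL(Fin (d + 1), ℝ) (PointedDomain d) where
  continuous_smul := by
    refine PointedDomain.isEmbedding_closure_point.continuous_iff.2 (Continuous.prodMk ?_ ?_)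
    · simp only [PointedDomain.closure_smul]
      refine Continuous.nonemptyCompacts_map'
        (g := fun (x : PGL(Fin (d + 1), ℝ) × PointedDomain d) (q : RealProj d) ↦ x.1 • q)
        (PointedDomain.continuous_closure.comp continuous_snd) ?_
      exact (continuous_fst.comp continuous_fst).smul continuous_snd
    · exact continuous_fst.smul (PointedDomain.continuous_point.comp continuous_snd)

/-! ### Properness -/

theorem PointedDomain.eventually_closure_subset {α : Type*} {l : Filter α}
    {p : α → PointedDomain d} {p₀ : PointedDomain d} (hp : Tendsto p l (𝓝 p₀))
    {U : Set (RealProj d)} (hU : IsOpen U) (h : _root_.closure p₀.carrier ⊆ U) :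
    ∀ᶠ i in l, _root_.closure (p i).carrier ⊆ U :=
  ((continuous_closure.tendsto p₀).comp hp).eventually
    ((NonemptyCompacts.isOpen_subsets_of_isOpen hU).mem_nhds h)

theorem PointedDomain.eventually_inter_nonempty {α : Type*} {l : Filter α}
    {p : α → PointedDomain d} {p₀ : PointedDomain d} (hp : Tendsto p l (𝓝 p₀))
    {U : Set (RealProj d)} (hU : IsOpen U) (h : (p₀.carrier ∩ U).Nonempty) :
    ∀ᶠ i in l, ((p i).carrier ∩ U).Nonempty := by
  have h1 : ∀ᶠ i in l, (((p i).closure : Set (RealProj d)) ∩ U).Nonempty :=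
    ((continuous_closure.tendsto p₀).comp hp).eventually
      ((NonemptyCompacts.isOpen_inter_nonempty_of_isOpen hU).mem_nhds
        (h.mono (inter_subset_inter_left _ subset_closure)))
  filter_upwards [h1] with i hi
  obtain ⟨q, hq, hqU⟩ := hi
  obtain ⟨r, hrU, hr⟩ := mem_closure_iff.1 hq U hU hqU
  exact ⟨r, hr, hrU⟩

/-- If `p i → p₀` and `g i • p i → q₀`, and if matrices of the `g i` converge to a matrix `A` that
kills a vector of the open cone over `p₀`, then `A` is annihilated by each functional that does
not vanish on the closure of `q₀`. -/
theorem dual_comp_eq_zero_of_tendsto {α : Type*} {𝒰 : Ultrafilter α}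
    {p q : α → PointedDomain d} {p₀ q₀ : PointedDomain d}
    (hp : Tendsto p 𝒰 (𝓝 p₀)) (hq : Tendsto q 𝒰 (𝓝 q₀)) {g : α → GL (Fin (d + 1)) ℝ}
    (hg : ∀ i, Matrix.ProjGenLinGroup.mk (g i) • p i = q i)
    {A : Matrix (Fin (d + 1)) (Fin (d + 1)) ℝ} (hA : Tendsto (fun i ↦ (g i).1) 𝒰 (𝓝 A))
    {f₀ f : Module.Dual ℝ (Fin (d + 1) → ℝ)}
    (hf₀ : closure p₀.carrier ⊆ affineChart f₀) (hf : closure q₀.carrier ⊆ affineChart f)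
    {v : Fin (d + 1) → ℝ} (hv : v ∈ coneOver f₀ p₀.carrier) (hAv : A.mulVec v = 0) :
    f ∘ₗ A.mulVecLin = 0 := by
  have hp' := PointedDomain.eventually_closure_subset hp (isOpen_affineChart f₀) hf₀
  have hq' := PointedDomain.eventually_closure_subset hq (isOpen_affineChart f) hf
  have hsign : ∀ᶠ i in (𝒰 : Filter α),
      (∀ w ∈ coneOver f₀ (p i).carrier, 0 < f ((g i).1.mulVec w)) ∨
      ∀ w ∈ coneOver f₀ (p i).carrier, f ((g i).1.mulVec w) < 0 := by
    filter_upwards [hp', hq'] with i hpi hqi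
    obtain ⟨f₁, h1, h2, -⟩ := (p i).exists_chart
    have hc := convex_coneOver_of_subset_affineChart (subset_closure.trans h1)
      (subset_closure.trans hpi) h2
    refine dual_pos_or_neg_of_convex (f := f ∘ₗ (g i).1.mulVecLin) hc ?_
    rintro w ⟨-, hw, hwS⟩
    have hmem : Matrix.ProjGenLinGroup.mk (g i) • Projectivization.mk ℝ w hw ∈
        (q i).carrier := by
      rw [← hg i]
      exact smul_mem_smul_set hwS
    exact (mk_mem_affineChart f _ _).1 (hqi (subset_closure hmem))
  have hpos : ∀ f : Module.Dual ℝ (Fin (d + 1) → ℝ), (∀ᶠ i in (𝒰 : Filter α),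
      ∀ w ∈ coneOver f₀ (p i).carrier, 0 < f ((g i).1.mulVec w)) → f ∘ₗ A.mulVecLin = 0 := by
    intro f hf
    refine eq_zero_of_nonneg_on_open (isOpen_coneOver (f := f₀) p₀.isOpen_carrier) ?_ hv
      (by simp [hAv])
    intro w hw
    -- Otherwise `f (g i *ᵥ u) < 0` for `g i` near `A` and `u` near `w`, and by Hausdorff
    -- convergence the cone over `p i` contains such a `u`.
    by_contra! hneg
    have hcont : Continuous fun x : Matrix (Fin (d + 1)) (Fin (d + 1)) ℝ × (Fin (d + 1) → ℝ) ↦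
        f (x.1.mulVec x.2) :=
      (continuous_dual f).comp (Continuous.matrix_mulVec continuous_fst continuous_snd)
    have hev : ∀ᶠ x in 𝓝 A ×ˢ 𝓝 w, f (x.1.mulVec x.2) < 0 := by
      rw [← nhds_prod_eq]
      exact hcont.continuousAt.eventually_lt continuousAt_const hneg
    obtain ⟨P, hP, Q, hQ, hPQ⟩ := eventually_prod_iff.1 hev
    obtain ⟨N, hNQ, hN, hwN⟩ := eventually_nhds_iff.1 hQ
    have hf₀o := isOpen_lt (continuous_const (y := (0 : ℝ))) (continuous_dual f₀)
    have hmeet := PointedDomain.eventually_inter_nonempty hp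
      (isOpen_image_mk (hN.inter hf₀o)) ⟨_, hw.2.2, w, ⟨hwN, hw.1⟩, hw.2.1, rfl⟩
    obtain ⟨i, hi, hPi, _, hri, u, hu, hu0, rfl⟩ := (hf.and ((hA.eventually hP).and hmeet)).exists
    exact (hPQ hPi (hNQ _ hu.1)).not_gt (hi u ⟨hu.2, hu0, hri⟩)
  -- Along an ultrafilter one of the two signs prevails.
  rcases Ultrafilter.eventually_or.1 hsign with h | h
  · exact hpos f h
  · have := hpos (-f) (by simpa using h)
    rwa [LinearMap.neg_comp, neg_eq_zero] at this

/-- A limit of matrices that move convergent pointed domains to convergent pointed domains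
does not kill the limit point. -/
theorem mulVec_ne_zero_of_tendsto {α : Type*} {𝒰 : Ultrafilter α}
    {p q : α → PointedDomain d} {p₀ q₀ : PointedDomain d}
    (hp : Tendsto p 𝒰 (𝓝 p₀)) (hq : Tendsto q 𝒰 (𝓝 q₀)) {g : α → GL (Fin (d + 1)) ℝ}
    (hg : ∀ i, Matrix.ProjGenLinGroup.mk (g i) • p i = q i)
    {A : Matrix (Fin (d + 1)) (Fin (d + 1)) ℝ} (hA : Tendsto (fun i ↦ (g i).1) 𝒰 (𝓝 A))
    (hA0 : A ≠ 0) {v : Fin (d + 1) → ℝ} (hv : v ≠ 0)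
    (hvp : Projectivization.mk ℝ v hv = p₀.point) : A.mulVec v ≠ 0 := by
  intro hAv
  obtain ⟨f₀, hf₀, -⟩ := p₀.exists_chart
  obtain ⟨f, hf, -, ε, hε, hfε⟩ := q₀.exists_chart
  obtain ⟨w, hw, hw0, hwp⟩ := exists_mem_coneOver (subset_closure.trans hf₀) p₀.point_mem
  have hAw : A.mulVec w = 0 := by
    obtain ⟨a, rfl⟩ := (Projectivization.mk_eq_mk_iff' ℝ _ _ hw0 hv).1 (hwp.trans hvp.symm)
    rw [Matrix.mulVec_smul, hAv, smul_zero]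
  have h0 := dual_comp_eq_zero_of_tendsto hp hq hg hA hf₀ hf hw hAw
  apply hA0
  ext i j
  -- Subtracting the identities for `f` and `f + ε • coordDual i` leaves row `i` of `A`.
  have h1 := dual_comp_eq_zero_of_tendsto hp hq hg hA hf₀
    (hfε ε (abs_of_pos hε).le i).1 hw hAw
  have h2 := LinearMap.congr_fun h1 (Pi.single j 1)
  have h3 := LinearMap.congr_fun h0 (Pi.single j 1)
  simp only [LinearMap.comp_apply, LinearMap.add_apply, LinearMap.smul_apply,
    LinearMap.zero_apply] at h2 h3
  rw [h3, zero_add, smul_eq_mul, mul_eq_zero] at h2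
  simpa using h2.resolve_left hε.ne'

theorem exists_isCompact_representatives (d : ℕ) :
    ∃ K : Set (Matrix (Fin (d + 1)) (Fin (d + 1)) ℝ), IsCompact K ∧ 0 ∉ K ∧
      ∀ g : PGL(Fin (d + 1), ℝ), ∃ a : GL (Fin (d + 1)) ℝ,
        Matrix.ProjGenLinGroup.mk a = g ∧ a.1 ∈ K := by
  -- Matrices are read as functions, with the sup norm; the unit sphere keeps limits away from zero.
  let K : Set (Fin (d + 1) → Fin (d + 1) → ℝ) := Metric.sphere 0 1
  have hK : IsCompact K := isCompact_sphere _ _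
  have h0 : (0 : Fin (d + 1) → Fin (d + 1) → ℝ) ∉ K := by simp [K]
  refine ⟨K, hK, h0, fun g ↦ ?_⟩
  induction g using Matrix.ProjGenLinGroup.induction_on with
  | mk g =>
    let B : Fin (d + 1) → Fin (d + 1) → ℝ := g.1
    have hB : B ≠ 0 := g.ne_zero
    have hn : ‖B‖ ≠ 0 := norm_ne_zero_iff.2 hB
    let u : ℝˣ := (Units.mk0 ‖B‖ hn)⁻¹
    refine ⟨g * Matrix.GeneralLinearGroup.scalar (Fin (d + 1)) u, ?_, ?_⟩
    · rw [map_mul, Matrix.ProjGenLinGroup.mk_scalar, mul_one]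
    · have h1 : (g * Matrix.GeneralLinearGroup.scalar (Fin (d + 1)) u).1 = ‖B‖⁻¹ • B := by
        change g.1 * Matrix.scalar (Fin (d + 1)) ‖B‖⁻¹ = _
        ext i j
        rw [Matrix.scalar_apply, Matrix.mul_diagonal, mul_comm]
        rfl
      rw [h1]
      change ‖B‖⁻¹ • B ∈ Metric.sphere 0 1
      rw [mem_sphere_zero_iff_norm, norm_smul, norm_inv, norm_norm, inv_mul_cancel₀ hn]

theorem tendsto_smul_of_mulVec_ne_zero {α : Type*} {l : Filter α} {g : α → GL (Fin (d + 1)) ℝ}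
    {A : Matrix (Fin (d + 1)) (Fin (d + 1)) ℝ} (hA : Tendsto (fun i ↦ (g i).1) l (𝓝 A))
    {y : α → RealProj d} {v : Fin (d + 1) → ℝ} {hv : v ≠ 0}
    (hy : Tendsto y l (𝓝 (Projectivization.mk ℝ v hv))) (hAv : A.mulVec v ≠ 0) :
    Tendsto (fun i ↦ Matrix.ProjGenLinGroup.mk (g i) • y i) l
      (𝓝 (Projectivization.mk ℝ (A.mulVec v) hAv)) := by
  refine tendsto_nhds.2 fun O hO hmem ↦ ?_
  have hcont : Continuous fun x : Matrix (Fin (d + 1)) (Fin (d + 1)) ℝ × (Fin (d + 1) → ℝ) ↦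
      x.1.mulVec x.2 := Continuous.matrix_mulVec continuous_fst continuous_snd
  have hev := hcont.continuousAt.eventually_mem (x := (A, v))
    ((isOpen_exists_mk_mem hO).mem_nhds ⟨hAv, hmem⟩)
  rw [nhds_prod_eq] at hev
  obtain ⟨P, hP, Q, hQ, hPQ⟩ := eventually_prod_iff.1 hev
  obtain ⟨N, hNQ, hN, hvN⟩ := eventually_nhds_iff.1 hQ
  filter_upwards [hA.eventually hP,
    hy.eventually ((isOpen_image_mk hN).mem_nhds ⟨v, hvN, hv, rfl⟩)] with i hPi hyi
  obtain ⟨w, hw, hw0, hwy⟩ := hyi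
  rw [mem_preimage, ← hwy]
  exact (hPQ hPi (hNQ _ hw)).2

/-- The topology of a unit group is induced by `g ↦ (g, g⁻¹)`. -/
theorem tendsto_of_tendsto_inv {α : Type*} {l : Filter α} {g : α → GL (Fin (d + 1)) ℝ}
    {G : GL (Fin (d + 1)) ℝ} (h1 : Tendsto (fun i ↦ (g i).1) l (𝓝 G.1))
    (h2 : Tendsto (fun i ↦ (g i)⁻¹.1) l (𝓝 G⁻¹.1)) : Tendsto g l (𝓝 G) := by
  rw [Units.isInducing_embedProduct.tendsto_nhds_iff, nhds_prod_eq]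
  exact h1.prodMk ((MulOpposite.continuous_op.tendsto _).comp h2)

theorem properSMul_pointedDomain (d : ℕ) : ProperSMul PGL(Fin (d + 1), ℝ) (PointedDomain d) := by
  rw [properSMul_iff_continuousSMul_ultrafilter_tendsto_t2]
  refine ⟨inferInstance, fun 𝒰 q₀ p₀ h ↦ ?_⟩
  have hq : Tendsto (fun x : PGL(Fin (d + 1), ℝ) × PointedDomain d ↦ x.1 • x.2) 𝒰 (𝓝 q₀) :=
    (continuous_fst.tendsto _).comp h
  have hp : Tendsto (fun x : PGL(Fin (d + 1), ℝ) × PointedDomain d ↦ x.2) 𝒰 (𝓝 p₀) :=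
    (continuous_snd.tendsto _).comp h
  obtain ⟨K, hK, hK0, hrep⟩ := exists_isCompact_representatives d
  choose ρ hρ hρK using hrep
  have hlim : ∀ r : PGL(Fin (d + 1), ℝ) × PointedDomain d → PGL(Fin (d + 1), ℝ),
      ∃ A ∈ K, Tendsto (fun x ↦ (ρ (r x)).1) 𝒰 (𝓝 A) := fun r ↦
    hK.ultrafilter_le_nhds (𝒰.map fun x ↦ (ρ (r x)).1)
      (tendsto_principal.2 (Eventually.of_forall fun x ↦ hρK (r x)))
  obtain ⟨A, hAK, hA⟩ := hlim Prod.fst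
  obtain ⟨B, hBK, hB⟩ := hlim fun x ↦ x.1⁻¹
  have hA0 : A ≠ 0 := fun h ↦ hK0 (h ▸ hAK)
  have hB0 : B ≠ 0 := fun h ↦ hK0 (h ▸ hBK)
  have hgA : ∀ x : PGL(Fin (d + 1), ℝ) × PointedDomain d,
      Matrix.ProjGenLinGroup.mk (ρ x.1) • x.2 = x.1 • x.2 := fun x ↦ by rw [hρ]
  have hgB : ∀ x : PGL(Fin (d + 1), ℝ) × PointedDomain d,
      Matrix.ProjGenLinGroup.mk (ρ x.1⁻¹) • x.1 • x.2 = x.2 := fun x ↦ by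
    rw [hρ, inv_smul_smul]
  have hAx := mulVec_ne_zero_of_tendsto hp hq hgA hA hA0 p₀.point.rep_nonzero p₀.point.mk_rep
  have hBy := mulVec_ne_zero_of_tendsto hq hp hgB hB hB0 q₀.point.rep_nonzero q₀.point.mk_rep
  have hBp : Projectivization.mk ℝ _ hBy = p₀.point := by
    refine tendsto_nhds_unique (l := (𝒰 : Filter (PGL(Fin (d + 1), ℝ) × PointedDomain d)))
      (f := fun x ↦ x.2.point) ?_
      ((PointedDomain.continuous_point.tendsto _).comp hp)
    have hy := (PointedDomain.continuous_point.tendsto _).comp hq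
    rw [← q₀.point.mk_rep] at hy
    refine (tendsto_smul_of_mulVec_ne_zero hB hy hBy).congr fun x ↦ ?_
    exact congrArg PointedDomain.point (hgB x)
  -- The representatives of `g` and `g⁻¹` are inverse only up to a scalar, read off at the entry
  -- `(0, 0)`.
  let c : PGL(Fin (d + 1), ℝ) × PointedDomain d → ℝ := fun x ↦
    ((ρ x.1).1 * (ρ x.1⁻¹).1) 0 0
  have hAB := hA.mul hB
  have hc : Tendsto c 𝒰 (𝓝 ((A * B) 0 0)) :=
    ((continuous_id.matrix_elem 0 0).tendsto _).comp hAB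
  have hscalar : ∀ x : PGL(Fin (d + 1), ℝ) × PointedDomain d,
      c x ≠ 0 ∧ (ρ x.1).1 * (ρ x.1⁻¹).1 = c x • 1 := by
    intro x
    have h1 : Matrix.ProjGenLinGroup.mk (1 : GL (Fin (d + 1)) ℝ) =
        Matrix.ProjGenLinGroup.mk (ρ x.1 * ρ x.1⁻¹) := by
      rw [map_mul, hρ, hρ, mul_inv_cancel, map_one]
    obtain ⟨u, hu⟩ := Matrix.ProjGenLinGroup.mk_eq_mk_iff.1 h1
    have h2 : (ρ x.1).1 * (ρ x.1⁻¹).1 = (u : ℝ) • 1 := by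
      rw [← Units.val_mul, ← hu, one_mul]
      change Matrix.scalar (Fin (d + 1)) (u : ℝ) = _
      rw [Matrix.scalar_apply, Matrix.smul_one_eq_diagonal]
    have h3 : c x = u := by simp [c, h2]
    rw [h3]
    exact ⟨u.ne_zero, h2⟩
  have hABc : A * B = (A * B) 0 0 • 1 :=
    tendsto_nhds_unique hAB
      ((hc.smul_const (1 : Matrix (Fin (d + 1)) (Fin (d + 1)) ℝ)).congr fun x ↦ (hscalar x).2.symm)
  -- If the scalar were zero then `A * B = 0`, but `B` sends the point of `q₀` to that of `p₀`,
  -- which `A` does not kill.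
  have hc0 : (A * B) 0 0 ≠ 0 := by
    intro h0
    obtain ⟨a, ha⟩ := (Projectivization.mk_eq_mk_iff' ℝ _ _ p₀.point.rep_nonzero hBy).1
      (p₀.point.mk_rep.trans hBp.symm)
    apply hAx
    rw [← ha, Matrix.mulVec_smul, Matrix.mulVec_mulVec, hABc, h0, zero_smul, Matrix.zero_mulVec,
      smul_zero]
  have hG : A * (((A * B) 0 0)⁻¹ • B) = 1 := by
    rw [Matrix.mul_smul]
    nth_rewrite 2 [hABc]
    rw [smul_smul, inv_mul_cancel₀ hc0, one_smul]
  let G : GL (Fin (d + 1)) ℝ := ⟨A, ((A * B) 0 0)⁻¹ • B, hG, mul_eq_one_comm.1 hG⟩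
  have hρG : Tendsto (fun x : PGL(Fin (d + 1), ℝ) × PointedDomain d ↦ ρ x.1) 𝒰 (𝓝 G) := by
    refine tendsto_of_tendsto_inv hA (((hc.inv₀ hc0).smul hB).congr fun x ↦ ?_)
    refine (Units.inv_eq_of_mul_eq_one_right ?_).symm
    rw [Matrix.mul_smul, (hscalar x).2, smul_smul, inv_mul_cancel₀ (hscalar x).1, one_smul]
  refine ⟨Matrix.ProjGenLinGroup.mk G, ?_⟩
  refine (((isOpenQuotientMap_projGenLinGroup_mk d).continuous.tendsto G).comp hρG).congr
    fun x ↦ hρ x.1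

/-! ### Simplices of maximal volume in the dual cone -/

/-- The affine slice `{u | u ⬝ x = 1}` of the dual cone of `C`. -/
def dualSlice (C : Set (Fin (d + 1) → ℝ)) (x : Fin (d + 1) → ℝ) : Set (Fin (d + 1) → ℝ) :=
  {u | u ⬝ᵥ x = 1 ∧ ∀ v ∈ C, 0 ≤ u ⬝ᵥ v}

theorem dual_apply_eq_dotProduct (f : Module.Dual ℝ (Fin (d + 1) → ℝ)) (v : Fin (d + 1) → ℝ) :
    (fun j ↦ f (Pi.single j 1)) ⬝ᵥ v = f v := by
  rw [LinearMap.pi_apply_eq_sum_univ f v]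
  simp only [dotProduct, smul_eq_mul]
  refine Finset.sum_congr rfl fun j _ ↦ ?_
  rw [mul_comm]
  congr 2
  ext k
  simp [Pi.single_apply, eq_comm]

/-- If `C` contains the ball of radius `r` around `x`, nonnegativity of `u` at `x ± r e_i` gives `|u
i| ≤ 1 / r`. -/
theorem isCompact_dualSlice {C : Set (Fin (d + 1) → ℝ)} (hC : IsOpen C)
    {x : Fin (d + 1) → ℝ} (hx : x ∈ C) : IsCompact (dualSlice C x) := by
  have hcl : IsClosed (dualSlice C x) := by
    have h1 : ∀ v : Fin (d + 1) → ℝ, Continuous fun u : Fin (d + 1) → ℝ ↦ u ⬝ᵥ v := fun v ↦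
      continuous_id.dotProduct continuous_const
    have h2 : dualSlice C x = {u | u ⬝ᵥ x = 1} ∩ ⋂ v ∈ C, {u | 0 ≤ u ⬝ᵥ v} := by
      ext u
      simp [dualSlice]
    rw [h2]
    exact (isClosed_eq (h1 x) continuous_const).inter
      (isClosed_biInter fun v _ ↦ isClosed_le continuous_const (h1 v))
  obtain ⟨r, hr, hball⟩ := Metric.nhds_basis_closedBall.mem_iff.1 (hC.mem_nhds hx)
  refine Metric.isCompact_of_isClosed_isBounded hcl
    ((Metric.isBounded_closedBall (x := 0) (r := r⁻¹)).subset fun u hu ↦ ?_)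
  rw [mem_closedBall_zero_iff, pi_norm_le_iff_of_nonneg (by positivity)]
  intro i
  have key : ∀ s : ℝ, |s| ≤ r → 0 ≤ 1 + s * u i := by
    intro s hs
    have hmem : x + Pi.single i s ∈ C := by
      apply hball
      rw [mem_closedBall_iff_norm, add_sub_cancel_left, Pi.norm_single]
      exact hs
    have := hu.2 _ hmem
    rw [dotProduct_add, hu.1, dotProduct_single] at this
    linarith
  have h1 := key r (abs_of_pos hr).le
  have h2 := key (-r) (by rw [abs_neg]; exact (abs_of_pos hr).le)
  rw [Real.norm_eq_abs, abs_le, inv_eq_one_div]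
  constructor
  · rw [neg_le, le_div_iff₀ hr]
    linarith
  · rw [le_div_iff₀ hr]
    linarith

/-- This makes the maximal volume positive. The rows are the functionals `f + t e_i*`, normalized at
`x`. -/
theorem exists_det_ne_zero_of_dualSlice {C : Set (Fin (d + 1) → ℝ)}
    {x : Fin (d + 1) → ℝ} (hx : x ∈ C) {f : Module.Dual ℝ (Fin (d + 1) → ℝ)} {ε : ℝ} (hε : 0 < ε)
    (hf : ∀ t : ℝ, |t| ≤ ε → ∀ (i : Fin (d + 1)), ∀ v ∈ C,
      0 < (f + t • coordDual i) v) :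
    ∃ A : Matrix (Fin (d + 1)) (Fin (d + 1)) ℝ, A.det ≠ 0 ∧ ∀ i, A i ∈ dualSlice C x := by
  -- Before normalization the determinant is `t ^ d * (t + f 1)`, with `1` the all-ones vector.
  obtain ⟨t, ht0, ht, htf⟩ : ∃ t : ℝ, 0 < t ∧ t ≤ ε ∧ t + f 1 ≠ 0 := by
    by_cases h : ε + f 1 = 0
    · exact ⟨ε / 2, by linarith, by linarith, by intro h'; linarith⟩
    · exact ⟨ε, hε, le_rfl, h⟩
  have hf' := hf t (by rwa [abs_of_pos ht0])
  let F : Fin (d + 1) → Module.Dual ℝ (Fin (d + 1) → ℝ) := fun i ↦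
    (((f + t • coordDual i : Module.Dual ℝ (Fin (d + 1) → ℝ)) x)⁻¹) • (f + t • coordDual i)
  let A : Matrix (Fin (d + 1)) (Fin (d + 1)) ℝ := fun i j ↦ F i (Pi.single j 1)
  have hA : ∀ i v, A i ⬝ᵥ v = F i v := fun i v ↦ dual_apply_eq_dotProduct (F i) v
  refine ⟨A, ?_, fun i ↦ ⟨?_, fun v hv ↦ ?_⟩⟩
  · intro hdet
    obtain ⟨v, hv, hAv⟩ := Matrix.exists_mulVec_eq_zero_iff.2 hdet
    have h1 : ∀ i, f v + t * v i = 0 := by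
      intro i
      have h2 : F i v = 0 := by
        rw [← hA]
        exact congrFun hAv i
      have h3 := (mul_eq_zero.1 h2).resolve_left (inv_ne_zero (hf' i x hx).ne')
      simpa using h3
    have h2 : t • v = -(f v) • (1 : Fin (d + 1) → ℝ) := by
      ext i
      simp only [Pi.smul_apply, smul_eq_mul, Pi.one_apply]
      linarith [h1 i]
    have h3 := congrArg f h2
    simp only [map_smul, smul_eq_mul] at h3
    have h4 : f v * (t + f 1) = 0 := by linarith
    have h5 := (mul_eq_zero.1 h4).resolve_right htf
    apply hv
    ext i
    have h6 := h1 i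
    rw [h5, zero_add] at h6
    exact (mul_eq_zero.1 h6).resolve_left ht0.ne'
  · rw [hA]
    exact inv_mul_cancel₀ (hf' i x hx).ne'
  · rw [hA]
    exact mul_nonneg (inv_nonneg.2 (hf' i x hx).le) (hf' i v hv).le

/-- The open box of radius `1 / (d + 1)` around `(1, …, 1)`. -/
def unitBox (d : ℕ) : Set (Fin (d + 1) → ℝ) :=
  {w | ∀ i, |w i - 1| < 1 / (d + 1)}

/-- `a ⬝ w = 1 + ∑ a i (w i - 1)`, and each of the `d + 1` terms exceeds `-1 / (d + 1)`. -/
theorem sum_mul_pos_of_mem_unitBox {a w : Fin (d + 1) → ℝ} (ha : ∀ i, |a i| ≤ 1)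
    (hs : ∑ i, a i = 1) (hw : w ∈ unitBox d) : 0 < a ⬝ᵥ w := by
  have h1 : a ⬝ᵥ w = 1 + ∑ i, a i * (w i - 1) := by
    simp only [dotProduct, mul_sub, mul_one, Finset.sum_sub_distrib, hs]
    ring
  have h2 : ∀ i, -(1 / ((d : ℝ) + 1)) < a i * (w i - 1) := by
    intro i
    have h3 : |a i * (w i - 1)| < 1 / (d + 1) := by
      rw [abs_mul]
      exact (mul_le_of_le_one_left (abs_nonneg _) (ha i)).trans_lt (hw i)
    exact (abs_lt.1 h3).1
  have h3 : ∑ _i : Fin (d + 1), -(1 / ((d : ℝ) + 1)) < ∑ i, a i * (w i - 1) :=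
    Finset.sum_lt_sum_of_nonempty Finset.univ_nonempty fun i _ ↦ h2 i
  have h4 : ∑ _i : Fin (d + 1), -(1 / ((d : ℝ) + 1)) = -1 := by
    have : (d : ℝ) + 1 ≠ 0 := by positivity
    rw [Finset.sum_const, Finset.card_univ, Fintype.card_fin, nsmul_eq_mul]
    push_cast
    field_simp
  rw [h1]
  linarith

/-- Separate `v` from `C` by `φ`. Scaling in the cone gives `φ ≤ 0` on `C` and `0 ≤ φ v`; openness
gives `φ x < 0`, so `u = φ / φ x` works. -/
theorem exists_mem_dualSlice_of_notMem {C : Set (Fin (d + 1) → ℝ)} (hC : IsOpen C)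
    (hconv : Convex ℝ C) (hcone : ∀ a : ℝ, 0 < a → ∀ v ∈ C, a • v ∈ C)
    {x v : Fin (d + 1) → ℝ} (hx : x ∈ C) (hv : v ∉ C) : ∃ u ∈ dualSlice C x, u ⬝ᵥ v ≤ 0 := by
  obtain ⟨φ, hφ⟩ := geometric_hahn_banach_open_point hconv hC hv
  have hsm : ∀ c ∈ C, ∀ a : ℝ, 0 < a → a * φ c < φ v := fun c hc a ha ↦ by
    simpa using hφ _ (hcone a ha c hc)
  have hle : ∀ c ∈ C, φ c ≤ 0 := by
    intro c hc
    by_contra! h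
    have := hsm c hc ((|φ v| + 1) / φ c) (by positivity)
    rw [div_mul_cancel₀ _ h.ne'] at this
    linarith [le_abs_self (φ v)]
  have hx0 : φ x < 0 := by
    refine (hle x hx).lt_of_ne fun h0 ↦ ?_
    have h1 := eq_zero_of_nonneg_on_open (f := -(φ : (Fin (d + 1) → ℝ) →ₗ[ℝ] ℝ)) hC
      (fun c hc ↦ by simpa using hle c hc) hx (by simpa using h0)
    have h2 := LinearMap.congr_fun h1 v
    have h3 := hφ x hx
    simp only [LinearMap.neg_apply, LinearMap.zero_apply, neg_eq_zero] at h2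
    have h4 : φ v = 0 := h2
    linarith
  have hv0 : 0 ≤ φ v := by
    by_contra! h
    have := hsm x hx (φ v / (2 * φ x)) (div_pos_of_neg_of_neg h (by linarith))
    have h2 : φ v / (2 * φ x) * φ x = φ v / 2 := by
      have := hx0.ne
      field_simp
    linarith
  have hu : ∀ w, (fun j ↦ ((φ x)⁻¹ • (φ : (Fin (d + 1) → ℝ) →ₗ[ℝ] ℝ)) (Pi.single j 1)) ⬝ᵥ w =
      (φ x)⁻¹ * φ w := fun w ↦ dual_apply_eq_dotProduct _ w
  refine ⟨_, ⟨(hu x).trans (inv_mul_cancel₀ hx0.ne), fun c hc ↦ ?_⟩, (hu v).trans_le ?_⟩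
  · rw [hu]
    exact mul_nonneg_of_nonpos_of_nonpos (inv_nonpos.2 hx0.le) (hle c hc)
  · exact mul_nonpos_of_nonpos_of_nonneg (inv_nonpos.2 hx0.le) hv0

/-- A pointed sharp open convex cone can be moved by a linear map between the cone over a fixed
box and the positive orthant: as the rows of the map, take a simplex of maximal volume in the
slice of the dual cone. -/
theorem exists_normalizing_matrix {C : Set (Fin (d + 1) → ℝ)} (hC : IsOpen C)
    (hconv : Convex ℝ C) (hcone : ∀ a : ℝ, 0 < a → ∀ v ∈ C, a • v ∈ C)
    {x : Fin (d + 1) → ℝ} (hx : x ∈ C) {f : Module.Dual ℝ (Fin (d + 1) → ℝ)} {ε : ℝ} (hε : 0 < ε)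
    (hf : ∀ t : ℝ, |t| ≤ ε → ∀ (i : Fin (d + 1)), ∀ v ∈ C,
      0 < (f + t • coordDual i) v) :
    ∃ A : Matrix (Fin (d + 1)) (Fin (d + 1)) ℝ, A.det ≠ 0 ∧ A.mulVec x = 1 ∧
      (∀ v ∈ C, ∀ i, 0 ≤ A.mulVec v i) ∧ ∀ w ∈ unitBox d, ∃ v ∈ C, A.mulVec v = w := by
  obtain ⟨A₀, hA₀, hA₀mem⟩ := exists_det_ne_zero_of_dualSlice hx hε hf
  have hcomp : IsCompact (Set.pi univ fun _ : Fin (d + 1) ↦ dualSlice C x) :=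
    isCompact_univ_pi fun _ ↦ isCompact_dualSlice hC hx
  have hdetc : Continuous fun A : Fin (d + 1) → Fin (d + 1) → ℝ ↦ |(Matrix.of A).det| :=
    (Continuous.matrix_det (A := fun A : Fin (d + 1) → Fin (d + 1) → ℝ ↦ Matrix.of A)
      continuous_id).abs
  obtain ⟨A', hA'mem, hmax'⟩ := hcomp.exists_isMaxOn ⟨A₀, fun i _ ↦ hA₀mem i⟩ hdetc.continuousOn
  let A : Matrix (Fin (d + 1)) (Fin (d + 1)) ℝ := Matrix.of A'
  have hAmem : ∀ i, A i ∈ dualSlice C x := fun i ↦ hA'mem i (mem_univ i)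
  have hmax : ∀ B : Matrix (Fin (d + 1)) (Fin (d + 1)) ℝ, (∀ i, B i ∈ dualSlice C x) →
      |B.det| ≤ |A.det| := fun B hB ↦ hmax' (a := B) fun i _ ↦ hB i
  have hdet : A.det ≠ 0 := by
    have := (abs_pos.2 hA₀).trans_le (hmax A₀ hA₀mem)
    exact abs_pos.1 this
  have hAx : A.mulVec x = 1 := funext fun i ↦ (hAmem i).1
  refine ⟨A, hdet, hAx, fun v hv i ↦ (hAmem i).2 v hv, fun w hw ↦ ?_⟩
  have hinv : A.mulVec (A⁻¹.mulVec w) = w := by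
    rw [Matrix.mulVec_mulVec, Matrix.mul_nonsing_inv _ (isUnit_iff_ne_zero.2 hdet),
      Matrix.one_mulVec]
  refine ⟨A⁻¹.mulVec w, ?_, hinv⟩
  by_contra hv
  obtain ⟨u, hu, huv⟩ := exists_mem_dualSlice_of_notMem hC hconv hcone hx hv
  -- Cramer's rule: the coefficients of `u` in the rows of `A`. Each numerator replaces a row by
  -- `u`, another point of the slice, so maximality bounds the quotient by `1`.
  let a : Fin (d + 1) → ℝ := A.det⁻¹ • A.transpose.cramer u
  have ha : ∀ i, |a i| ≤ 1 := by
    intro i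
    have h1 : |(A.updateRow i u).det| ≤ |A.det| := by
      refine hmax _ fun k ↦ ?_
      by_cases hk : k = i
      · subst hk
        rwa [Matrix.updateRow_self]
      · rw [Matrix.updateRow_ne hk]
        exact hAmem k
    change |A.det⁻¹ * A.transpose.cramer u i| ≤ 1
    rw [Matrix.cramer_transpose_apply, abs_mul, abs_inv]
    exact inv_mul_le_one_of_le₀ h1 (abs_nonneg _)
  have hau : ∀ y, u ⬝ᵥ y = a ⬝ᵥ A.mulVec y := by
    intro y
    have h1 : A.transpose.mulVec a = u := by
      rw [Matrix.mulVec_smul, Matrix.mulVec_cramer, Matrix.det_transpose, smul_smul,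
        inv_mul_cancel₀ hdet, one_smul]
    rw [Matrix.dotProduct_mulVec, ← Matrix.mulVec_transpose, h1]
  -- `u` and all rows of `A` take the value `1` at `x`.
  have hsum : ∑ i, a i = 1 := by
    have h1 := hau x
    rw [hu.1, hAx, dotProduct_one] at h1
    exact h1.symm
  have := sum_mul_pos_of_mem_unitBox ha hsum hw
  rw [hau, hinv] at huv
  linarith

/-! ### Convex sets between the box and the simplex -/

/-- The sum of the coordinates. -/
def sumDual (d : ℕ) : Module.Dual ℝ (Fin (d + 1) → ℝ) := ∑ i, coordDual i

theorem sumDual_apply (v : Fin (d + 1) → ℝ) : sumDual d v = ∑ i, v i := by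
  simp [sumDual]

/-- The closed simplex of lines spanned by vectors with nonnegative coordinates. -/
def simplexSet (d : ℕ) : Set (RealProj d) :=
  {p | ∀ i j, 0 ≤ p.rep i * p.rep j}

/-- Products of two coordinates scale by a square, so their signs do not depend on the
representative. -/
theorem mk_mem_simplexSet {v : Fin (d + 1) → ℝ} (hv : v ≠ 0) :
    Projectivization.mk ℝ v hv ∈ simplexSet d ↔ ∀ i j, 0 ≤ v i * v j := by
  obtain ⟨a, ha⟩ := Projectivization.exists_smul_eq_mk_rep ℝ v hv
  have h : ∀ i j, (Projectivization.mk ℝ v hv).rep i * (Projectivization.mk ℝ v hv).rep j =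
      (a : ℝ) ^ 2 * (v i * v j) := by
    intro i j
    rw [← ha]
    simp only [Units.smul_def, Pi.smul_apply, smul_eq_mul]
    ring
  have ha2 : 0 < (a : ℝ) ^ 2 := sq_pos_iff.2 a.ne_zero
  simp only [simplexSet, mem_ofPred_eq, h, mul_nonneg_iff_of_pos_left ha2]

theorem isClosed_simplexSet (d : ℕ) : IsClosed (simplexSet d) := by
  rw [← (isOpenQuotientMap_proj d).isQuotientMap.isClosed_preimage]
  have h : proj d ⁻¹' simplexSet d =
      ⋂ i, ⋂ j, {v : {v : Fin (d + 1) → ℝ // v ≠ 0} | 0 ≤ v.1 i * v.1 j} := by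
    ext v
    simp only [mem_iInter]
    exact mk_mem_simplexSet v.2
  have hc : ∀ k, Continuous fun v : {v : Fin (d + 1) → ℝ // v ≠ 0} ↦ v.1 k := fun k ↦
    (continuous_apply k).comp continuous_subtype_val
  rw [h]
  exact isClosed_iInter fun i ↦ isClosed_iInter fun j ↦
    isClosed_le continuous_const ((hc i).mul (hc j))

theorem simplexSet_subset_affineChart (d : ℕ) : simplexSet d ⊆ affineChart (sumDual d) := by
  intro p hp h0
  rw [sumDual_apply] at h0
  apply p.rep_nonzero
  ext i
  have h1 : ∑ j, p.rep i * p.rep j = 0 := by rw [← Finset.mul_sum, h0, mul_zero]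
  have h2 := (Finset.sum_eq_zero_iff_of_nonneg fun j _ ↦ hp i j).1 h1 i (Finset.mem_univ i)
  exact mul_self_eq_zero.1 h2

theorem isBounded_inChart_sumDual {S : Set (RealProj d)} (hS : S ⊆ simplexSet d) :
    Bornology.IsBounded (inChart (sumDual d) S) := by
  refine (Metric.isBounded_closedBall (x := 0) (r := 1)).subset ?_
  rintro v ⟨h1, hv, hvS⟩
  have h2 := (mk_mem_simplexSet hv).1 (hS hvS)
  rw [sumDual_apply] at h1
  have h3 : ∀ i, 0 ≤ v i := by
    intro i
    have : 0 ≤ ∑ j, v i * v j := Finset.sum_nonneg fun j _ ↦ h2 i j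
    rwa [← Finset.mul_sum, h1, mul_one] at this
  rw [mem_closedBall_zero_iff, pi_norm_le_iff_of_nonneg zero_le_one]
  intro i
  rw [Real.norm_eq_abs, abs_of_nonneg (h3 i), ← h1]
  exact Finset.single_le_sum (fun j _ ↦ h3 j) (Finset.mem_univ i)

/-- If a combination of `v` and `w` spans a line outside `L`, separate that line from `L` by open
sets. A set `M` close to `L` has vectors near `v` and `w` in its cone, and their combination spans a
line on the wrong side. -/
theorem isClosed_convex_coneOver (f : Module.Dual ℝ (Fin (d + 1) → ℝ)) :
    IsClosed {L : NonemptyCompacts (RealProj d) | Convex ℝ (coneOver f (L : Set (RealProj d)))} := by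
  have hf := isOpen_lt (continuous_const (y := (0 : ℝ))) (continuous_dual f)
  refine isClosed_of_closure_subset fun L hL v hv w hw a b ha hb hab ↦ ?_
  have hpos : 0 < f (a • v + b • w) :=
    (convex_halfSpace_gt f.isLinear 0) hv.1 hw.1 ha hb hab
  refine ⟨hpos, ne_zero_of_dual_pos hpos, ?_⟩
  by_contra hnot
  obtain ⟨O, N, hO, hN, hLO, huN, hON⟩ := SeparatedNhds.of_isCompact_isCompact L.isCompact
    isCompact_singleton (disjoint_singleton_right.2 hnot)
  have hcont : Continuous fun x : (Fin (d + 1) → ℝ) × (Fin (d + 1) → ℝ) ↦ a • x.1 + b • x.2 := by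
    fun_prop
  have hev := hcont.continuousAt.eventually_mem (x := (v, w))
    ((isOpen_coneOver (f := f) hN).mem_nhds ⟨hpos, ne_zero_of_dual_pos hpos, huN rfl⟩)
  rw [nhds_prod_eq] at hev
  obtain ⟨P, hP, Q, hQ, hPQ⟩ := eventually_prod_iff.1 hev
  obtain ⟨V, hVP, hV, hvV⟩ := eventually_nhds_iff.1 hP
  obtain ⟨W, hWQ, hW, hwW⟩ := eventually_nhds_iff.1 hQ
  obtain ⟨M, ⟨⟨hMO, hMV⟩, hMW⟩, hM⟩ := mem_closure_iff.1 hL _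
    (((NonemptyCompacts.isOpen_subsets_of_isOpen hO).inter
      (NonemptyCompacts.isOpen_inter_nonempty_of_isOpen (isOpen_image_mk (hV.inter hf)))).inter
      (NonemptyCompacts.isOpen_inter_nonempty_of_isOpen (isOpen_image_mk (hW.inter hf))))
    ⟨⟨hLO, _, hv.2.2, v, ⟨hvV, hv.1⟩, hv.2.1, rfl⟩, _, hw.2.2, w, ⟨hwW, hw.1⟩, hw.2.1, rfl⟩
  obtain ⟨_, hv'M, v', hv', hv'0, rfl⟩ := hMV
  obtain ⟨_, hw'M, w', hw', hw'0, rfl⟩ := hMW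
  have h1 : a • v' + b • w' ∈ coneOver f (M : Set (RealProj d)) :=
    hM ⟨hv'.2, hv'0, hv'M⟩ ⟨hw'.2, hw'0, hw'M⟩ ha hb hab
  have h2 : a • v' + b • w' ∈ coneOver f N := hPQ (hVP _ hv'.1) (hWQ _ hw'.1)
  exact hON.ne_of_mem (hMO h1.2.2) h2.2.2 rfl

/-- The convex compact sets between the fixed box around `[1 : … : 1]` and the simplex. -/
def normalizedCompacts (d : ℕ) : Set (NonemptyCompacts (RealProj d)) :=
  {L | (∀ w ∈ unitBox d, ∀ hw : w ≠ 0, Projectivization.mk ℝ w hw ∈ L) ∧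
    (L : Set (RealProj d)) ⊆ simplexSet d ∧
    Convex ℝ (coneOver (sumDual d) (L : Set (RealProj d)))}

theorem isClosed_normalizedCompacts (d : ℕ) : IsClosed (normalizedCompacts d) := by
  have h1 : ∀ p : RealProj d, IsClosed {L : NonemptyCompacts (RealProj d) | p ∈ L} := by
    intro p
    convert NonemptyCompacts.isClosed_inter_nonempty_of_isClosed (isClosed_singleton (x := p))
      using 2
    ext L
    simp
  have h2 : IsClosed {L : NonemptyCompacts (RealProj d) |
      ∀ w ∈ unitBox d, ∀ hw : w ≠ 0, Projectivization.mk ℝ w hw ∈ L} := by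
    simp only [ofPred_forall]
    exact isClosed_iInter fun w ↦ isClosed_iInter fun _ ↦ isClosed_iInter fun _ ↦ h1 _
  exact h2.inter ((NonemptyCompacts.isClosed_subsets_of_isClosed (isClosed_simplexSet d)).inter
    (isClosed_convex_coneOver _))

theorem isOpen_unitBox (d : ℕ) : IsOpen (unitBox d) := by
  have h : unitBox d = ⋂ i, {w : Fin (d + 1) → ℝ | |w i - 1| < 1 / ((d : ℝ) + 1)} := by
    ext w
    simp [unitBox]
  rw [h]
  exact isOpen_iInter_of_finite fun i ↦
    isOpen_lt ((continuous_apply i).sub continuous_const).abs continuous_const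

theorem one_mem_unitBox (d : ℕ) : (1 : Fin (d + 1) → ℝ) ∈ unitBox d := fun i ↦ by
  simp only [Pi.one_apply, sub_self, abs_zero]
  positivity

theorem pos_of_mem_unitBox {w : Fin (d + 1) → ℝ} (hw : w ∈ unitBox d) (i : Fin (d + 1)) :
    0 < w i := by
  have h1 := (abs_lt.1 (hw i)).1
  have h2 : 1 / ((d : ℝ) + 1) ≤ 1 := by
    rw [div_le_one (by positivity)]
    linarith [(Nat.cast_nonneg d : (0 : ℝ) ≤ d)]
  linarith

theorem sumDual_pos_of_mem_unitBox {w : Fin (d + 1) → ℝ} (hw : w ∈ unitBox d) :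
    0 < sumDual d w := by
  rw [sumDual_apply]
  exact Finset.sum_pos (fun i _ ↦ pos_of_mem_unitBox hw i) Finset.univ_nonempty

/-- The point `[1 : … : 1]`. -/
noncomputable def centralPoint (d : ℕ) : RealProj d :=
  Projectivization.mk ℝ (1 : Fin (d + 1) → ℝ) one_ne_zero

section normalizedCompacts

variable {L : NonemptyCompacts (RealProj d)}

theorem unitBox_subset_coneOver (hL : L ∈ normalizedCompacts d) :
    unitBox d ⊆ coneOver (sumDual d) (L : Set (RealProj d)) := fun w hw ↦
  have h := sumDual_pos_of_mem_unitBox hw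
  ⟨h, ne_zero_of_dual_pos h, hL.1 w hw _⟩

theorem centralPoint_mem_interior (hL : L ∈ normalizedCompacts d) :
    centralPoint d ∈ interior (L : Set (RealProj d)) := by
  have h : (1 : Fin (d + 1) → ℝ) ∈ coneOver (sumDual d) (interior (L : Set (RealProj d))) := by
    rw [coneOver_interior]
    exact interior_maximal (unitBox_subset_coneOver hL) (isOpen_unitBox d) (one_mem_unitBox d)
  exact h.2.2

/-- The interior of a normalized convex compact set, pointed at `[1 : … : 1]`. -/
noncomputable def normalizedDomain (hL : L ∈ normalizedCompacts d) : PointedDomain d where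
  carrier := interior (L : Set (RealProj d))
  point := centralPoint d
  isOpen_carrier := isOpen_interior
  isProperlyConvex := by
    have hs : interior (L : Set (RealProj d)) ⊆ simplexSet d := interior_subset.trans hL.2.1
    refine ⟨sumDual d, ?_, hs.trans (simplexSet_subset_affineChart d), ?_,
      isBounded_inChart_sumDual hs⟩
    · intro h
      have := sumDual_pos_of_mem_unitBox (one_mem_unitBox d)
      simp [h] at this
    · rw [convex_inChart_iff, coneOver_interior]
      exact hL.2.2.interior
  point_mem := centralPoint_mem_interior hL

/-- A convex set with nonempty interior lies in the closure of its interior. -/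
theorem closure_normalizedDomain (hL : L ∈ normalizedCompacts d) :
    (normalizedDomain hL).closure = L := by
  refine NonemptyCompacts.ext (Subset.antisymm ?_ ?_)
  · exact closure_minimal interior_subset L.isCompact.isClosed
  · refine subset_of_coneOver_subset (hL.2.1.trans (simplexSet_subset_affineChart d)) ?_
    change _ ⊆ coneOver (sumDual d) (closure (interior (L : Set (RealProj d))))
    rw [coneOver_closure, coneOver_interior, hL.2.2.closure_interior_eq_closure_of_nonempty_interior
      ⟨1, interior_maximal (unitBox_subset_coneOver hL) (isOpen_unitBox d) (one_mem_unitBox d)⟩]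
    exact fun v hv ↦ ⟨subset_closure hv, hv.1⟩

end normalizedCompacts

/-! ### Cocompactness -/

/-- The normalized pointed domains. -/
def normalizedDomains (d : ℕ) : Set (PointedDomain d) :=
  {p | p.closure ∈ normalizedCompacts d ∧ p.point = centralPoint d}

/-- The embedding maps this set onto the product of a closed set in the compact hyperspace of `ℙ^d`
with a point. -/
theorem isCompact_normalizedDomains (d : ℕ) : IsCompact (normalizedDomains d) := by
  rw [PointedDomain.isEmbedding_closure_point.isInducing.isCompact_iff]
  convert (isClosed_normalizedCompacts d).isCompact.prod (isCompact_singleton (x := centralPoint d))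
    using 1
  ext ⟨L, q⟩
  constructor
  · rintro ⟨p, ⟨h1, h2⟩, h⟩
    obtain ⟨rfl, rfl⟩ := Prod.ext_iff.1 h
    exact ⟨h1, h2⟩
  · rintro ⟨hL, rfl⟩
    exact ⟨normalizedDomain hL, ⟨by rwa [closure_normalizedDomain], rfl⟩,
      Prod.ext (closure_normalizedDomain hL) rfl⟩

theorem exists_smul_mem_normalizedDomains (p : PointedDomain d) :
    ∃ g : PGL(Fin (d + 1), ℝ), g • p ∈ normalizedDomains d := by
  obtain ⟨f, hf, hconv, ε, hε, hfε⟩ := p.exists_chart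
  obtain ⟨x, hx, hx0, hxp⟩ := exists_mem_coneOver (subset_closure.trans hf) p.point_mem
  obtain ⟨A, hdet, hAx, hApos, hbox⟩ := exists_normalizing_matrix
    (isOpen_coneOver (f := f) p.isOpen_carrier) hconv (fun a ha v hv ↦ smul_mem_coneOver ha hv)
    hx hε fun t ht i v hv ↦ (hfε t ht i).2 v (coneOver_mono subset_closure hv)
  let g : GL (Fin (d + 1)) ℝ := Matrix.GeneralLinearGroup.mkOfDetNeZero A hdet
  have hg : ∀ v, g • v = A.mulVec v := fun v ↦ rfl
  let q := (Matrix.ProjGenLinGroup.mk g : PGL(Fin (d + 1), ℝ)) • p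
  have hsub : q.carrier ⊆ simplexSet d := by
    rintro _ ⟨r, hr, rfl⟩
    obtain ⟨v, hv, hv0, rfl⟩ := exists_mem_coneOver (subset_closure.trans hf) hr
    refine (mk_mem_simplexSet ((smul_ne_zero_iff_ne g).2 hv0)).2 fun i j ↦ ?_
    exact mul_nonneg (hApos v hv i) (hApos v hv j)
  refine ⟨Matrix.ProjGenLinGroup.mk g, ⟨fun w hw hw0 ↦ ?_, ?_, ?_⟩, ?_⟩
  · obtain ⟨v, hv, rfl⟩ := hbox w hw
    exact subset_closure (s := q.carrier) ⟨_, hv.2.2, rfl⟩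
  · exact closure_minimal hsub (isClosed_simplexSet d)
  · obtain ⟨f', hf', hc', -⟩ := q.exists_chart
    have h := convex_coneOver_of_subset_affineChart (subset_closure.trans hf')
      (hsub.trans (simplexSet_subset_affineChart d)) hc'
    change Convex ℝ (coneOver (sumDual d) (closure q.carrier))
    rw [coneOver_closure]
    exact h.closure.inter (convex_halfSpace_gt (sumDual d).isLinear 0)
  · change Matrix.ProjGenLinGroup.mk g • p.point = centralPoint d
    rw [← hxp, Projectivization.PGL.mk_smul_mk]
    simp only [hg, hAx]
    rfl

theorem isCocompactAction_pointedDomain (d : ℕ) :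
    IsCocompactAction PGL(Fin (d + 1), ℝ) (PointedDomain d) := by
  refine ⟨⟨normalizedDomains d, isCompact_normalizedDomains d, ?_⟩, ⟨?_⟩⟩
  · refine eq_univ_of_forall fun p ↦ mem_iUnion.2 ?_
    obtain ⟨g, hg⟩ := exists_smul_mem_normalizedDomains p
    exact ⟨g⁻¹, mem_inv_smul_set_iff.2 hg⟩
  · have h : IsCompact ((Quotient.mk _ : PointedDomain d →
        MulAction.orbitRel.Quotient PGL(Fin (d + 1), ℝ) (PointedDomain d)) ''
          normalizedDomains d) :=
      (isCompact_normalizedDomains d).image continuous_quot_mk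
    convert h
    refine (eq_univ_of_forall fun y ↦ ?_).symm
    induction y using Quotient.inductionOn with
    | h p =>
      obtain ⟨g, hg⟩ := exists_smul_mem_normalizedDomains p
      exact ⟨g • p, hg, Quotient.sound ⟨g, rfl⟩⟩

end HilbertGeometry

theorem mainTheorem1 (d : ℕ) :
    ProperSMul PGL(Fin (d + 1), ℝ) (HilbertGeometry.PointedDomain d) ∧
      HilbertGeometry.IsCocompactAction PGL(Fin (d + 1), ℝ) (HilbertGeometry.PointedDomain d) :=
  ⟨HilbertGeometry.properSMul_pointedDomain d, HilbertGeometry.isCocompactAction_pointedDomain d⟩
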